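/- Let $D$ be a strongly connected digraph with countable (finite or infinite) vertex set and at least one arc; loops are allowed, multiple arcs are not. All cycles are directed, a loop being a cycle of length $1$. Let $\ell_{\min}(D)$ be the length of a shortest cycle of $D$, and let $\ell_{\max}(D)\in\mathbb N\cup\{\infty\}$ be the supremum of the lengths of its cycles. A cycle transversal of $D$ is a set of vertices whose removal (with all incident arcs) leaves a digraph without cycles, and $|sct(D)|\in\mathbb N\cup\{\infty\}$ is the size of a smallest cycle transversal ($\infty$ if no finite one exists). Let $\mathcal S_<(D)$ be the set of truly substochastic weightings of $D$, i.e. of the positive functions $S$ on the arcs of $D$ such that for every vertex the sum of the weights of the arcs leaving it is at most $1$, and for at least one vertex it is strictly less than $1$. For $S\in\mathcal S_<(D)$ and $n\in\mathbb N$, let $\lambda_S(D,n)$ be the supremum of the Perron roots (spectral radii of the weighted adjacency matrices) of the induced subdigraphs of $D$ on at most $n$ vertices, weighted by $S$. Then the following hold. 1. Exactly one of the following alternatives holds: (a) for every function $g:\mathbb N\to(0,\infty)$ there is $S\in\mathcal S_<(D)$ such that $1-\lambda_S(D,n)<g(n)$ for every $n\ge\ell_{\min}(D)$; (b) for every $S\in\mathcal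 S_<(D)$ there is $c_S>0$, not depending on $n$, such that $n\bigl(1-\lambda_S(D,n)\bigr)>c_S$ for every $n\ge1$. 2. Alternative (b) holds if and only if $|sct(D)|<\infty$. 3. The statement "for every $S\in\mathcal S_<(D)$ there is $\delta_S>0$, not depending on $n$, such that $1-\lambda_S(D,n)>\delta_S$ for every $n\ge1$" holds if and only if $|sct(D)|<\infty$ and $\ell_{\max}(D)<\infty$. -/

import Mathlib

namespace Digraph

/-- A digraph is strong if there is a directed path from `v` to `w` for every pair of distinct
vertices `v`, `w`. -/
def IsStrong {V : Type*} (D : Digraph V) : Prop :=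
  ∀ v w : V, v ≠ w → Relation.ReflTransGen D.Adj v w

/-- `c` enumerates in cyclic order the vertices of a directed cycle of length `l` of `D`: the
vertices are pairwise distinct and there is an arc from each of them to the next one.
A loop is a cycle of length one. -/
def IsCycle {V : Type*} (D : Digraph V) (l : ℕ) (c : ZMod l → V) : Prop :=
  0 < l ∧ Function.Injective c ∧ ∀ i : ZMod l, D.Adj (c i) (c (i + 1))

/-- The set of the lengths of the directed cycles of `D`. -/
def cycleLengths {V : Type*} (D : Digraph V) : Set ℕ :=
  {l | ∃ c : ZMod l → V, D.IsCycle l c}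

/-- The length of a shortest cycle (`⊤` if there are no cycles). -/
noncomputable def minCycleLength {V : Type*} (D : Digraph V) : ℕ∞ :=
  ⨅ l ∈ D.cycleLengths, (l : ℕ∞)

/-- The supremum of the lengths of the cycles: it is `⊤` if and only if the lengths are
unbounded. -/
noncomputable def maxCycleLength {V : Type*} (D : Digraph V) : ℕ∞ :=
  ⨆ l ∈ D.cycleLengths, (l : ℕ∞)

/-- The digraph obtained from `D` by removing the vertices in `T` with all incident arcs. -/
def deleteVertices {V : Type*} (D : Digraph V) (T : Set V) : Digraph {v : V // v ∉ T} where
  Adj v w := D.Adj v w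

/-- A set of vertices is a cycle transversal if no cycle is left after its removal. -/
def IsCycleTransversal {V : Type*} (D : Digraph V) (T : Set V) : Prop :=
  (D.deleteVertices T).cycleLengths = ∅

/-- The size of a smallest cycle transversal (`⊤` if there is no finite one). -/
noncomputable def sctCard {V : Type*} (D : Digraph V) : ℕ∞ :=
  ⨅ (T : Set V) (_ : D.IsCycleTransversal T), T.encard

/-- A weighting of `D`: a positive function on the arcs. -/
structure Weighting {V : Type*} (D : Digraph V) where
  /-- The weight of an arc. -/
  weight : {a : V × V // D.Adj a.1 a.2} → ℝ
  weight_pos : ∀ a, 0 < weight a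

namespace Weighting

open Classical in
/-- The weighted adjacency matrix. -/
noncomputable def adjMatrix {V : Type*} {D : Digraph V} (W : D.Weighting) : Matrix V V ℝ :=
  Matrix.of fun v w => if h : D.Adj v w then W.weight ⟨(v, w), h⟩ else 0

/-- The out-weight of a vertex: the sum (possibly infinite) of the weights of the arcs
leaving it. -/
noncomputable def outWeight {V : Type*} {D : Digraph V} (W : D.Weighting) (v : V) : ENNReal :=
  ∑' w : {w : V // D.Adj v w}, ENNReal.ofReal (W.weight ⟨(v, w.1), w.2⟩)

/-- Every out-weight is at most `1`. -/
def IsSubstochastic {V : Type*} {D : Digraph V} (W : D.Weighting) : Prop :=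
  ∀ v, W.outWeight v ≤ 1

/-- Substochastic, and some out-weight is strictly less than `1`. -/
def IsTrulySubstochastic {V : Type*} {D : Digraph V} (W : D.Weighting) : Prop :=
  W.IsSubstochastic ∧ ∃ v, W.outWeight v < 1

open Classical in
/-- The Perron root (the spectral radius of the weighted adjacency matrix) of the subdigraph
induced on a finite set `F` of vertices. -/
noncomputable def perronRoot {V : Type*} {D : Digraph V} (W : D.Weighting) (F : Finset V) : ℝ :=
  (spectralRadius ℂ ((W.adjMatrix.submatrix (fun v : F => (v : V)) (fun v : F => (v : V))).map
    (fun x : ℝ => (x : ℂ)))).toReal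

/-- The supremum of the Perron roots of the induced subdigraphs on at most `n` vertices
(these Perron roots are at most `1` if the weighting is substochastic). -/
noncomputable def perronSup {V : Type*} {D : Digraph V} (W : D.Weighting) (n : ℕ) : ℝ :=
  ⨆ F : {F : Finset V // F.card ≤ n}, W.perronRoot F.1

end Weighting

end Digraph

namespace Digraph

/-! Read a substochastic weighting as a random walk, killed by the missing out-weight and on leaving
a finite set `F`. Row sums of powers of the matrix of `F` are survival probabilities, so they bound
the Perron root from above; the geometric mean of the weights along a closed walk bounds it from
below.

Upper bounds. Let `T` be a finite transversal. By strong connectivity there are `k` and `p > 0` such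
that, from every vertex of `T`, the walk dies within `k` steps with probability at least `p`,
whatever `F` is. A path in `F` avoiding `T` has at most `n` vertices, so survival for about `k + n`
steps has probability at most `1 - p`, and Bernoulli's inequality gives `1 - ρ ≥ p / (k + n)`
(`exists_le_mul_one_sub_perronRoot`). If cycles have length at most `L`, enlarge `T` to a finite set
inducing a strong digraph: a path outside it closes up through it to a cycle, so `L` replaces `n`.

Constructions. Without a finite transversal there are infinitely many disjoint cycles, whose arcs
can all be given weights as close to 1 as desired. If cycles are merely unbounded, they may meet;
each is chosen so long that the few vertices shared with earlier ones barely lower its geometric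
mean. -/

theorem exists_nodup_isChain_of_reflTransGen {α : Type*} {r : α → α → Prop} {a b : α}
    (h : Relation.ReflTransGen r a b) :
    ∃ l : List α, (a :: l).Nodup ∧ (a :: l).IsChain r ∧
      (a :: l).getLast (List.cons_ne_nil _ _) = b := by
  induction h using Relation.ReflTransGen.head_induction_on with
  | refl => exact ⟨[], by simp, by simp, by simp⟩
  | @head a c hac _ ih =>
    obtain ⟨l, hn, hc, hl⟩ := ih
    by_cases ha : a ∈ c :: l
    · obtain ⟨s, t, hst⟩ := List.append_of_mem ha
      refine ⟨t, ?_, ?_, ?_⟩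
      · rw [hst] at hn
        exact hn.of_append_right
      · rw [hst] at hc
        exact hc.right_of_append
      · rw [← hl]
        simp only [hst]
        rw [List.getLast_append_of_ne_nil]
    · exact ⟨c :: l, List.nodup_cons.2 ⟨ha, hn⟩, List.isChain_cons_cons.2 ⟨hac, hc⟩, by simpa using hl⟩

/-! ### Directed cycles as lists and as periodic sequences; transversals. -/

variable {V : Type*} {D : Digraph V}

theorem length_mem_cycleLengths {l : List V} (hl : l ≠ []) (hn : l.Nodup) (hc : l.IsChain D.Adj)
    (hlast : D.Adj (l.getLast hl) (l.head hl)) : l.length ∈ D.cycleLengths := by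
  have hpos : 0 < l.length := List.length_pos_iff.2 hl
  have : NeZero l.length := ⟨hpos.ne'⟩
  refine ⟨fun i => l[i.val]'(ZMod.val_lt i), hpos, ?_, ?_⟩
  · intro i j hij
    exact ZMod.val_injective _ ((List.Nodup.getElem_inj_iff hn).1 hij)
  · intro i
    have hi := ZMod.val_lt i
    by_cases h : i.val + 1 < l.length
    · have hv : (i + 1).val = i.val + 1 := by
        have h1 : i + 1 = ((i.val + 1 : ℕ) : ZMod l.length) := by simp
        rw [h1, ZMod.val_natCast, Nat.mod_eq_of_lt h]
      simp only [hv]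
      exact List.isChain_iff_getElem.1 hc _ h
    · have hv : (i + 1).val = 0 := by
        have h1 : i + 1 = ((i.val + 1 : ℕ) : ZMod l.length) := by simp
        have h2 : i.val + 1 = l.length := by omega
        rw [h1, ZMod.val_natCast, h2, Nat.mod_self]
      have h2 : i.val = l.length - 1 := by omega
      simp only [hv, h2]
      simpa [List.getLast_eq_getElem, List.head_eq_getElem] using hlast

theorem cycleLengths_nonempty_of_transGen {v : V} (h : Relation.TransGen D.Adj v v) :
    D.cycleLengths.Nonempty := by
  obtain ⟨b, hb, hbv⟩ := Relation.TransGen.tail'_iff.1 h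
  obtain ⟨l, hn, hc, hl⟩ := exists_nodup_isChain_of_reflTransGen hb
  exact ⟨_, length_mem_cycleLengths (List.cons_ne_nil _ _) hn hc (by rw [hl]; simpa using hbv)⟩

theorem IsStrong.reflTransGen (hD : D.IsStrong) (v w : V) : Relation.ReflTransGen D.Adj v w := by
  by_cases h : v = w
  · exact h ▸ Relation.ReflTransGen.refl
  · exact hD v w h

theorem IsStrong.cycleLengths_nonempty (hD : D.IsStrong) (harc : ∃ v w : V, D.Adj v w) :
    D.cycleLengths.Nonempty := by
  obtain ⟨v, w, h⟩ := harc
  exact cycleLengths_nonempty_of_transGen (Relation.TransGen.head' h (hD.reflTransGen w v))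

/-- A list of consecutive vertices of a digraph without cycles has no repetitions. -/
theorem nodup_of_isChain (hD : D.cycleLengths = ∅) {l : List V} (hl : l.IsChain D.Adj) :
    l.Nodup := by
  have h := (hl.imp (S := Relation.TransGen D.Adj) fun _ _ => Relation.TransGen.single).pairwise
  refine h.imp fun {a b} hab e => ?_
  subst e
  exact (cycleLengths_nonempty_of_transGen hab).ne_empty hD

/-- A directed cycle, given by a periodic sequence of vertices. -/
structure CycleSeq (D : Digraph V) where
  /-- The vertices in cyclic order. -/
  seq : ℕ → V
  /-- The length of the cycle. -/
  length : ℕ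
  length_pos : 0 < length
  injOn : Set.InjOn seq (Finset.range length)
  adj : ∀ i, D.Adj (seq i) (seq (i + 1))
  periodic : Function.Periodic seq length

namespace CycleSeq

open Classical in
/-- The set of the vertices of a cycle. -/
noncomputable def support (C : D.CycleSeq) : Finset V := (Finset.range C.length).image C.seq

theorem card_support (C : D.CycleSeq) : C.support.card = C.length := by
  classical
  rw [support, Finset.card_image_of_injOn C.injOn, Finset.card_range]

theorem seq_mem_support (C : D.CycleSeq) (i : ℕ) : C.seq i ∈ C.support := by
  classical
  rw [← C.periodic.map_mod_nat i]
  exact Finset.mem_image_of_mem _ (Finset.mem_range.2 (Nat.mod_lt _ C.length_pos))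

theorem seq_succ_eq (C : D.CycleSeq) {i j : ℕ} (h : C.seq i = C.seq j) :
    C.seq (i + 1) = C.seq (j + 1) := by
  have h1 : i % C.length = j % C.length := by
    refine C.injOn ?_ ?_ ?_
    · simpa using Nat.mod_lt _ C.length_pos
    · simpa using Nat.mod_lt _ C.length_pos
    · rwa [C.periodic.map_mod_nat, C.periodic.map_mod_nat]
  rw [← C.periodic.map_mod_nat (i + 1), ← C.periodic.map_mod_nat (j + 1)]
  exact congrArg C.seq (Nat.ModEq.add_right 1 h1)

end CycleSeq

theorem exists_cycleSeq {l : ℕ} (h : l ∈ D.cycleLengths) :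
    ∃ C : D.CycleSeq, C.length = l := by
  obtain ⟨c, hl, hinj, hadj⟩ := h
  refine ⟨⟨fun i => c (i : ZMod l), l, hl, ?_, fun i => by simpa using hadj (i : ZMod l),
    fun i => by simp⟩, rfl⟩
  intro i hi j hj hij
  have := hinj hij
  rw [ZMod.natCast_eq_natCast_iff'] at this
  simp only [Finset.coe_range, Set.mem_Iio] at hi hj
  rwa [Nat.mod_eq_of_lt hi, Nat.mod_eq_of_lt hj] at this

theorem sctCard_lt_top_iff : D.sctCard < ⊤ ↔ ∃ T : Set V, T.Finite ∧ D.IsCycleTransversal T := by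
  simp only [sctCard, iInf_lt_top, Set.encard_lt_top_iff]
  exact ⟨fun ⟨T, h1, h2⟩ => ⟨T, h2, h1⟩, fun ⟨T, h1, h2⟩ => ⟨T, h2, h1⟩⟩

theorem maxCycleLength_lt_top_iff :
    D.maxCycleLength < ⊤ ↔ ∃ L : ℕ, ∀ l ∈ D.cycleLengths, l ≤ L := by
  constructor
  · intro h
    obtain ⟨L, hL⟩ := ENat.ne_top_iff_exists.1 h.ne
    refine ⟨L, fun l hl => ?_⟩
    have : (l : ℕ∞) ≤ D.maxCycleLength := le_iSup₂ (f := fun l (_ : l ∈ D.cycleLengths) => (l : ℕ∞)) l hl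
    rw [← hL] at this
    exact_mod_cast this
  · rintro ⟨L, hL⟩
    refine lt_of_le_of_lt (iSup₂_le (a := (L : ℕ∞)) fun l hl => ?_) (ENat.natCast_lt_top L)
    exact_mod_cast hL l hl

theorem exists_shortest_cycle (h : D.cycleLengths.Nonempty) :
    ∃ l ∈ D.cycleLengths, ∀ n : ℕ, D.minCycleLength ≤ n → l ≤ n := by
  refine ⟨sInf D.cycleLengths, Nat.sInf_mem h, fun n hn => ?_⟩
  have : ((sInf D.cycleLengths : ℕ) : ℕ∞) ≤ D.minCycleLength :=
    le_iInf₂ fun l hl => by exact_mod_cast Nat.sInf_le hl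
  exact_mod_cast this.trans hn

/-- A set containing a cycle transversal is a cycle transversal. -/
theorem IsCycleTransversal.mono {T U : Set V} (hT : D.IsCycleTransversal T) (h : T ⊆ U) :
    D.IsCycleTransversal U := by
  by_contra hne
  obtain ⟨l, c, hl, hinj, hadj⟩ := Set.nonempty_iff_ne_empty.2 hne
  refine Set.eq_empty_iff_forall_notMem.1 hT l
    ⟨fun i => ⟨(c i : V), fun hi => (c i).2 (h hi)⟩, hl, fun i j hij => hinj ?_, hadj⟩
  exact Subtype.ext (by simpa using hij)

theorem exists_cycleSeq_disjoint {U : Finset V} (hU : ¬ D.IsCycleTransversal U) :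
    ∃ C : D.CycleSeq, Disjoint C.support U := by
  classical
  obtain ⟨l, hl⟩ := Set.nonempty_iff_ne_empty.2 hU
  obtain ⟨C, -⟩ := exists_cycleSeq hl
  refine ⟨⟨fun i => C.seq i, C.length, C.length_pos,
    fun i hi j hj hij => C.injOn hi hj (Subtype.ext hij), C.adj, fun i => by simp [C.periodic i]⟩,
    Finset.disjoint_left.2 fun v hv => ?_⟩
  obtain ⟨i, -, rfl⟩ := Finset.mem_image.1 hv
  simpa using (C.seq i).2

end Digraph

namespace Digraph

/-! ### Spectral radius bounds for nonnegative matrices. -/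

section PerronRoot

-- This norm is the maximal absolute row sum, which for powers of the weighted matrix is a survival
-- probability.
attribute [local instance] Matrix.linftyOpNormedRing Matrix.linftyOpNormedAlgebra

variable {n : Type*} [Fintype n] [DecidableEq n]

theorem norm_entry_le_linftyOpNorm (A : Matrix n n ℂ) (i j : n) : ‖A i j‖₊ ≤ ‖A‖₊ := by
  rw [Matrix.linfty_opNNNorm_def]
  exact (Finset.single_le_sum (f := fun j => ‖A i j‖₊) (fun _ _ => zero_le)
    (Finset.mem_univ j)).trans
    (Finset.le_sup (f := fun i => ∑ j, ‖A i j‖₊) (Finset.mem_univ i))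

theorem matrix_pow_nonneg {A : Matrix n n ℝ} (hA : ∀ i j, 0 ≤ A i j) (k : ℕ) (i j : n) :
    0 ≤ (A ^ k) i j := by
  induction k generalizing i j with
  | zero => rw [pow_zero, Matrix.one_apply]; split_ifs <;> norm_num
  | succ k ih =>
    rw [pow_succ, Matrix.mul_apply]
    exact Finset.sum_nonneg fun w _ => mul_nonneg (ih _ _) (hA _ _)

theorem pow_diag_le_diag_pow {A : Matrix n n ℝ} (hA : ∀ i j, 0 ≤ A i j) (k : ℕ) (i : n) :
    (A i i) ^ k ≤ (A ^ k) i i := by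
  induction k with
  | zero => simp
  | succ k ih =>
    rw [pow_succ, pow_succ, Matrix.mul_apply]
    exact (mul_le_mul_of_nonneg_right ih (hA i i)).trans
      (Finset.single_le_sum (f := fun w => (A ^ k) i w * A w i)
        (fun w _ => mul_nonneg (matrix_pow_nonneg hA _ _ _) (hA _ _)) (Finset.mem_univ i))

theorem map_ofReal_pow (A : Matrix n n ℝ) (k : ℕ) :
    (A.map (fun x : ℝ => (x : ℂ))) ^ k = (A ^ k).map (fun x : ℝ => (x : ℂ)) :=
  (map_pow (RingHom.mapMatrix Complex.ofRealHom) A k).symm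

theorem spectralRadius_ne_top (A : Matrix n n ℂ) : spectralRadius ℂ A ≠ ⊤ := by
  have : CompleteSpace (Matrix n n ℂ) := FiniteDimensional.complete ℂ _
  refine ne_top_of_le_ne_top ?_ (spectrum.spectralRadius_le_pow_nnnorm_pow_one_div ℂ A 0)
  simp [ENNReal.mul_eq_top]

/-- Gelfand's formula along the multiples of `l`: the diagonal entry at `v` of `A ^ (l * m)` is at
least `r ^ (l * m)` and at most the norm. -/
theorem le_spectralRadius_of_pow_le {A : Matrix n n ℝ} (hA : ∀ i j, 0 ≤ A i j) {r : ℝ} (hr : 0 ≤ r)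
    {l : ℕ} (hl : 0 < l) (v : n) (h : r ^ l ≤ (A ^ l) v v) :
    r ≤ (spectralRadius ℂ (A.map (fun x : ℝ => (x : ℂ)))).toReal := by
  have : CompleteSpace (Matrix n n ℂ) := FiniteDimensional.complete ℂ _
  set B := A.map (fun x : ℝ => (x : ℂ)) with hB
  have hlim := spectrum.pow_nnnorm_pow_one_div_tendsto_nhds_spectralRadius B
  have hsub : Filter.Tendsto (fun m : ℕ => l * (m + 1)) Filter.atTop Filter.atTop :=
    Filter.tendsto_atTop_mono (fun m => (Nat.le_succ m).trans (Nat.le_mul_of_pos_left _ hl)) Filter.tendsto_id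
  have hle : ENNReal.ofReal r ≤ spectralRadius ℂ B := by
    refine ge_of_tendsto' (hlim.comp hsub) fun m => ?_
    have hk : 0 < l * (m + 1) := by positivity
    have h1 : r ^ (l * (m + 1)) ≤ (A ^ (l * (m + 1))) v v := by
      rw [pow_mul, pow_mul]
      exact (pow_le_pow_left₀ (pow_nonneg hr _) h _).trans
        (pow_diag_le_diag_pow (matrix_pow_nonneg hA l) (m + 1) v)
    have h2 : ENNReal.ofReal r ^ (l * (m + 1)) ≤ (‖B ^ (l * (m + 1))‖₊ : ENNReal) := by
      refine le_trans ?_ (ENNReal.coe_le_coe.2 (norm_entry_le_linftyOpNorm _ v v))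
      rw [← ENNReal.ofReal_pow hr, hB, map_ofReal_pow, Matrix.map_apply, ← enorm_eq_nnnorm,
        ← ofReal_norm, Complex.norm_real]
      exact ENNReal.ofReal_le_ofReal (h1.trans (le_abs_self _))
    have h3 := ENNReal.rpow_le_rpow h2 (z := 1 / ((l * (m + 1) : ℕ) : ℝ)) (by positivity)
    rw [← ENNReal.rpow_natCast, ← ENNReal.rpow_mul, mul_one_div_cancel (by positivity),
      ENNReal.rpow_one] at h3
    exact h3
  rw [← ENNReal.toReal_ofReal hr]
  exact ENNReal.toReal_mono (spectralRadius_ne_top B) hle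

theorem spectralRadius_pow_le_of_row_sum_le {A : Matrix n n ℝ} (hA : ∀ i j, 0 ≤ A i j) {q : ℝ}
    (hq : 0 ≤ q) {k : ℕ} (hk : k ≠ 0) (h : ∀ i, ∑ j, (A ^ k) i j ≤ q) :
    (spectralRadius ℂ (A.map (fun x : ℝ => (x : ℂ)))).toReal ^ k ≤ q := by
  have : CompleteSpace (Matrix n n ℂ) := FiniteDimensional.complete ℂ _
  set B := A.map (fun x : ℝ => (x : ℂ)) with hB
  obtain ⟨k, rfl⟩ := Nat.exists_eq_succ_of_ne_zero hk
  have h0 := spectrum.spectralRadius_le_pow_nnnorm_pow_one_div ℂ B k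
  -- The bound `h0` carries a power of this norm, which is 0 for an empty index type; the inequality
  -- covers both cases.
  have h1 : ‖(1 : Matrix n n ℂ)‖₊ ≤ 1 := by
    rw [Matrix.linfty_opNNNorm_def]
    refine Finset.sup_le fun i _ => ?_
    rw [Finset.sum_eq_single i] <;> simp +contextual [eq_comm]
  have h2 : (‖B ^ (k + 1)‖₊ : ENNReal) ≤ ENNReal.ofReal q := by
    rw [ENNReal.ofReal, ENNReal.coe_le_coe, Matrix.linfty_opNNNorm_def]
    refine Finset.sup_le fun i _ => ?_
    rw [← NNReal.coe_le_coe, Real.coe_toNNReal _ hq]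
    push_cast
    refine le_trans (Finset.sum_le_sum fun j _ => ?_) (h i)
    rw [hB, map_ofReal_pow, Matrix.map_apply, Complex.norm_real,
      Real.norm_of_nonneg (matrix_pow_nonneg hA _ _ _)]
  have h3 : spectralRadius ℂ B ≤ ENNReal.ofReal q ^ (1 / (k + 1 : ℝ)) := by
    refine h0.trans ?_
    calc _ ≤ ENNReal.ofReal q ^ (1 / (k + 1 : ℝ)) * 1 := by
          gcongr
          exact ENNReal.rpow_le_one (by exact_mod_cast h1) (by positivity)
      _ = _ := mul_one _
  have h4 : spectralRadius ℂ B ^ (k + 1) ≤ ENNReal.ofReal q := by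
    calc _ ≤ (ENNReal.ofReal q ^ (1 / (k + 1 : ℝ))) ^ (k + 1) := by gcongr
      _ = ENNReal.ofReal q := by
        rw [← ENNReal.rpow_natCast, ← ENNReal.rpow_mul]
        push_cast
        rw [one_div_mul_cancel (by positivity), ENNReal.rpow_one]
  have h5 := ENNReal.toReal_mono ENNReal.ofReal_ne_top h4
  rwa [ENNReal.toReal_pow, ENNReal.toReal_ofReal hq] at h5

end PerronRoot

/-! ### Killed walks and Perron roots. -/

namespace Weighting

variable {V : Type*} {D : Digraph V} (W : D.Weighting)

theorem adjMatrix_of_adj {v w : V} (h : D.Adj v w) : W.adjMatrix v w = W.weight ⟨(v, w), h⟩ := by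
  simp [adjMatrix, h]

theorem adjMatrix_nonneg (v w : V) : 0 ≤ W.adjMatrix v w := by
  by_cases h : D.Adj v w
  · rw [adjMatrix_of_adj W h]
    exact (W.weight_pos _).le
  · simp [adjMatrix, h]

theorem adjMatrix_pos_iff {v w : V} : 0 < W.adjMatrix v w ↔ D.Adj v w := by
  by_cases h : D.Adj v w
  · simp only [adjMatrix_of_adj W h, h, iff_true]
    exact W.weight_pos _
  · simp [adjMatrix, h]

theorem sum_adjMatrix_le {v : V} {q : ℝ} (h : W.outWeight v ≤ ENNReal.ofReal q) (hq : 0 ≤ q)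
    (F : Finset V) : ∑ w ∈ F, W.adjMatrix v w ≤ q := by
  classical
  have h1 : ∑ w ∈ F, W.adjMatrix v w = ∑ w ∈ F.subtype (D.Adj v), W.weight ⟨(v, w.1), w.2⟩ := by
    rw [← Finset.sum_filter_of_ne (p := D.Adj v), ← Finset.sum_subtype_eq_sum_filter]
    · exact Finset.sum_congr rfl fun w _ => adjMatrix_of_adj W w.2
    · intro w _ hw
      exact (adjMatrix_pos_iff W).1 (lt_of_le_of_ne (adjMatrix_nonneg W v w) hw.symm)
  rw [h1]
  have h2 := (ENNReal.sum_le_tsum (f := fun w : {w : V // D.Adj v w} =>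
    ENNReal.ofReal (W.weight ⟨(v, w.1), w.2⟩)) (F.subtype (D.Adj v))).trans h
  rw [← ENNReal.ofReal_sum_of_nonneg fun w _ => (W.weight_pos _).le] at h2
  exact (ENNReal.ofReal_le_ofReal_iff hq).1 h2

/-- The probability that the walk with transition weights `W` that is killed when it leaves `F`
makes at least `m` steps from `v`. -/
noncomputable def survival (F : Finset V) : ℕ → V → ℝ
  | 0, _ => 1
  | m + 1, v => ∑ w ∈ F, W.adjMatrix v w * survival F m w

theorem survival_nonneg (F : Finset V) (m : ℕ) (v : V) : 0 ≤ W.survival F m v := by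
  induction m generalizing v with
  | zero => simp [survival]
  | succ m ih => exact Finset.sum_nonneg fun w _ => mul_nonneg (W.adjMatrix_nonneg v w) (ih w)

variable {W}

theorem IsSubstochastic.sum_adjMatrix_le_one (hW : W.IsSubstochastic) (F : Finset V) (v : V) :
    ∑ w ∈ F, W.adjMatrix v w ≤ 1 :=
  W.sum_adjMatrix_le (by simpa using hW v) zero_le_one F

theorem IsSubstochastic.survival_succ_le (hW : W.IsSubstochastic) (F : Finset V) (m : ℕ) (v : V) :
    W.survival F (m + 1) v ≤ W.survival F m v := by
  induction m generalizing v with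
  | zero => simpa [survival] using hW.sum_adjMatrix_le_one F v
  | succ m ih =>
    exact Finset.sum_le_sum fun w _ => mul_le_mul_of_nonneg_left (ih w) (W.adjMatrix_nonneg v w)

theorem IsSubstochastic.survival_antitone (hW : W.IsSubstochastic) (F : Finset V) (v : V) :
    Antitone fun m => W.survival F m v :=
  antitone_nat_of_succ_le fun m => hW.survival_succ_le F m v

theorem IsSubstochastic.survival_le_one (hW : W.IsSubstochastic) (F : Finset V) (m : ℕ) (v : V) :
    W.survival F m v ≤ 1 := by
  simpa [survival] using hW.survival_antitone F v (Nat.zero_le m)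

variable (W)

/-- For `v ∈ F`, survival for `k` steps is the row sum at `v` of the `k`-th power of the matrix of
`F`. -/
theorem perronRoot_pow_le {F : Finset V} {k : ℕ} (hk : k ≠ 0) {q : ℝ} (hq : 0 ≤ q)
    (h : ∀ v ∈ F, W.survival F k v ≤ q) : W.perronRoot F ^ k ≤ q := by
  classical
  unfold perronRoot
  set A := W.adjMatrix.submatrix (fun v : F => (v : V)) (fun v : F => (v : V)) with hA
  have key : ∀ (k : ℕ) (i : F), ∑ j, (A ^ k) i j = W.survival F k i := by
    intro k
    induction k with
    | zero => intro i; simp [survival, Matrix.one_apply]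
    | succ k ih =>
      intro i
      simp only [pow_succ', Matrix.mul_apply, survival]
      rw [Finset.sum_comm, ← Finset.sum_coe_sort F]
      refine Finset.sum_congr rfl fun w _ => ?_
      rw [← Finset.mul_sum, ih w]
      rfl
  exact spectralRadius_pow_le_of_row_sum_le (fun i j => W.adjMatrix_nonneg _ _) hq hk
    fun i => (key k i).trans_le (h i i.2)

theorem perronRoot_nonneg (F : Finset V) : 0 ≤ W.perronRoot F := ENNReal.toReal_nonneg

/-- The weight of one closed walk is a summand of a diagonal entry of the `l`-th power; hence the
geometric mean of its arc weights is a lower bound. -/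
theorem le_perronRoot_of_closed_walk {F : Finset V} {f : ℕ → V} (hF : ∀ i, f i ∈ F) {l : ℕ}
    (hl : 0 < l) (hf : f l = f 0) {r : ℝ} (hr : 0 ≤ r)
    (h : r ^ l ≤ ∏ i ∈ Finset.range l, W.adjMatrix (f i) (f (i + 1))) :
    r ≤ W.perronRoot F := by
  classical
  unfold perronRoot
  set A := W.adjMatrix.submatrix (fun v : F => (v : V)) (fun v : F => (v : V)) with hA
  have hA0 : ∀ i j, 0 ≤ A i j := fun i j => W.adjMatrix_nonneg _ _
  refine le_spectralRadius_of_pow_le hA0 hr hl ⟨f 0, hF 0⟩ (h.trans ?_)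
  have key : ∀ k, ∏ i ∈ Finset.range k, W.adjMatrix (f i) (f (i + 1)) ≤
      (A ^ k) ⟨f 0, hF 0⟩ ⟨f k, hF k⟩ := by
    intro k
    induction k with
    | zero => simp
    | succ k ih =>
      rw [Finset.prod_range_succ, pow_succ, Matrix.mul_apply]
      refine (mul_le_mul_of_nonneg_right ih (W.adjMatrix_nonneg _ _)).trans ?_
      exact Finset.single_le_sum (f := fun w : F => (A ^ k) ⟨f 0, hF 0⟩ w * A w ⟨f (k + 1), hF _⟩)
        (fun w _ => mul_nonneg (matrix_pow_nonneg hA0 _ _ _) (hA0 _ _))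
        (Finset.mem_univ (⟨f k, hF k⟩ : F))
  have h1 := key l
  simpa only [hf] using h1

variable {W}

theorem IsSubstochastic.perronRoot_le_one (hW : W.IsSubstochastic) (F : Finset V) :
    W.perronRoot F ≤ 1 := by
  simpa using W.perronRoot_pow_le one_ne_zero zero_le_one fun v _ => hW.survival_le_one F 1 v

theorem IsSubstochastic.perronRoot_le_perronSup (hW : W.IsSubstochastic) {F : Finset V} {n : ℕ}
    (hF : F.card ≤ n) : W.perronRoot F ≤ W.perronSup n :=
  le_ciSup (f := fun F : {F : Finset V // F.card ≤ n} => W.perronRoot F.1)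
    ⟨1, by rintro _ ⟨F, rfl⟩; exact hW.perronRoot_le_one F⟩ ⟨F, hF⟩

theorem perronSup_le {n : ℕ} {q : ℝ} (h : ∀ F : Finset V, F.card ≤ n → W.perronRoot F ≤ q) :
    W.perronSup n ≤ q := by
  have : Nonempty {F : Finset V // F.card ≤ n} := ⟨⟨∅, by simp⟩⟩
  exact ciSup_le fun F => h F.1 F.2

end Weighting

end Digraph

/-! ### Lower bounds for `1 - perronSup` from a finite transversal. -/

namespace Digraph

variable {V : Type*} {D : Digraph V}

namespace Weighting

variable {W : D.Weighting}

/-- Induction along a path to a deficient vertex `x`: at `x` the deficit serves as `p`, and each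
step back multiplies `p` by an arc weight. Leaving `F` also kills, so nothing depends on `F`. -/
theorem IsTrulySubstochastic.exists_survival_le (hW : W.IsTrulySubstochastic) (hD : D.IsStrong)
    (v : V) : ∃ k : ℕ, ∃ p : ℝ, 0 < p ∧ p ≤ 1 ∧ ∀ F : Finset V, W.survival F k v ≤ 1 - p := by
  obtain ⟨hsub, x, hx⟩ := hW
  induction hD.reflTransGen v x using Relation.ReflTransGen.head_induction_on with
  | refl =>
    have hfin : W.outWeight x ≠ ⊤ := (hx.trans ENNReal.one_lt_top).ne
    have h1 : (W.outWeight x).toReal < 1 := by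
      simpa using (ENNReal.toReal_lt_toReal hfin ENNReal.one_ne_top).2 hx
    refine ⟨1, 1 - (W.outWeight x).toReal, by linarith, by linarith [ENNReal.toReal_nonneg (a := W.outWeight x)], fun F => ?_⟩
    simpa [survival] using
      W.sum_adjMatrix_le (ENNReal.ofReal_toReal hfin).ge ENNReal.toReal_nonneg F
  | @head a c hac _ ih =>
    classical
    obtain ⟨k, p, hp, hp1, hk⟩ := ih
    have hA := (W.adjMatrix_pos_iff).2 hac
    have hA1 : W.adjMatrix a c ≤ 1 := by simpa using hsub.sum_adjMatrix_le_one {c} a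
    refine ⟨k + 1, W.adjMatrix a c * p, mul_pos hA hp, mul_le_one₀ hA1 hp.le hp1, fun F => ?_⟩
    have hle : ∀ w, W.adjMatrix a w * W.survival F k w ≤
        W.adjMatrix a w - if w = c then W.adjMatrix a c * p else 0 := by
      intro w
      split_ifs with hwc
      · subst hwc
        have := mul_le_mul_of_nonneg_left (hk F) hA.le
        linarith
      · simpa using mul_le_mul_of_nonneg_left (hsub.survival_le_one F k w) (W.adjMatrix_nonneg a w)
    calc W.survival F (k + 1) a
        -- `c` may lie outside `F`; adding its nonnegative term treats both cases at once.
        ≤ ∑ w ∈ insert c F, W.adjMatrix a w * W.survival F k w :=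
          Finset.sum_le_sum_of_subset_of_nonneg (Finset.subset_insert c F) fun w _ _ =>
            mul_nonneg (W.adjMatrix_nonneg a w) (W.survival_nonneg F k w)
      _ ≤ ∑ w ∈ insert c F, (W.adjMatrix a w - if w = c then W.adjMatrix a c * p else 0) :=
          Finset.sum_le_sum fun w _ => hle w
      _ = ∑ w ∈ insert c F, W.adjMatrix a w - W.adjMatrix a c * p := by
          rw [Finset.sum_sub_distrib, Finset.sum_ite_eq' _ c, if_pos (Finset.mem_insert_self c F)]
      _ ≤ 1 - W.adjMatrix a c * p := by
          linarith [hsub.sum_adjMatrix_le_one (insert c F) a]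

theorem IsTrulySubstochastic.exists_survival_le_of_finite (hW : W.IsTrulySubstochastic)
    (hD : D.IsStrong) {T : Set V} (hT : T.Finite) :
    ∃ k : ℕ, ∃ p : ℝ, 0 < p ∧ p ≤ 1 ∧ ∀ v ∈ T, ∀ F : Finset V, W.survival F k v ≤ 1 - p := by
  induction T, hT using Set.Finite.induction_on with
  | empty => exact ⟨0, 1, one_pos, le_rfl, by simp⟩
  | @insert a s _ _ ih =>
    obtain ⟨k, p, hp, hp1, h⟩ := ih
    obtain ⟨k', p', hp', _, h'⟩ := hW.exists_survival_le hD a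
    refine ⟨max k k', min p p', lt_min hp hp', (min_le_left _ _).trans hp1, ?_⟩
    rintro v (rfl | hv) F
    · have := hW.1.survival_antitone F v (le_max_right k k')
      exact this.trans ((h' F).trans (by linarith [min_le_right p p']))
    · have := hW.1.survival_antitone F v (le_max_left k k')
      exact this.trans ((h v hv F).trans (by linarith [min_le_left p p']))

/-- Survival is a subconvex combination of the successors' survivals with one step fewer, so a value
above `1 - p` passes to some successor. While at least `k` steps remain, such a vertex cannot lie in
`T`. -/
theorem IsSubstochastic.exists_isChain_of_lt_survival (hW : W.IsSubstochastic) {T : Set V} {k : ℕ}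
    {p : ℝ} (hp1 : p ≤ 1) {F : Finset V} (hT : ∀ v ∈ T, W.survival F k v ≤ 1 - p) (m : ℕ) {v : V}
    (hv : v ∈ F) (h : 1 - p < W.survival F (k + m) v) :
    ∃ hvT : v ∉ T, ∃ l : List {v : V // v ∉ T}, (⟨v, hvT⟩ :: l).IsChain (D.deleteVertices T).Adj ∧
      l.length = m ∧ ∀ x ∈ l, (x : V) ∈ F := by
  have hvT : ∀ m, ∀ v, 1 - p < W.survival F (k + m) v → v ∉ T := fun m v h hv => by
    linarith [hT v hv, hW.survival_antitone F v (Nat.le_add_right k m)]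
  induction m generalizing v with
  | zero => exact ⟨hvT 0 v h, [], by simp, rfl, by simp⟩
  | succ m ih =>
    obtain ⟨w, hw, hA, hs⟩ : ∃ w ∈ F, 0 < W.adjMatrix v w ∧ 1 - p < W.survival F (k + m) w := by
      by_contra! hcon
      refine absurd h (not_lt.2 ?_)
      calc W.survival F (k + (m + 1)) v
          = ∑ w ∈ F, W.adjMatrix v w * W.survival F (k + m) w := rfl
        _ ≤ ∑ w ∈ F, W.adjMatrix v w * (1 - p) := by
          refine Finset.sum_le_sum fun w hw => ?_
          rcases (W.adjMatrix_nonneg v w).eq_or_lt with h0 | h0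
          · simp [← h0]
          · exact mul_le_mul_of_nonneg_left (hcon w hw h0) h0.le
        _ = (∑ w ∈ F, W.adjMatrix v w) * (1 - p) := (Finset.sum_mul ..).symm
        _ ≤ 1 * (1 - p) :=
          mul_le_mul_of_nonneg_right (hW.sum_adjMatrix_le_one F v) (by linarith)
        _ = 1 - p := one_mul _
    obtain ⟨hwT, l, hl, hlen, hlF⟩ := ih hw hs
    refine ⟨hvT _ v h, ⟨w, hwT⟩ :: l, List.isChain_cons_cons.2 ⟨?_, hl⟩, by simp [hlen], ?_⟩
    · exact (W.adjMatrix_pos_iff).1 hA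
    · simpa [hw] using hlF

/-- Common source of both bounds: `m` will be `n` in one and a constant in the other. -/
theorem IsTrulySubstochastic.exists_le_mul_one_sub_perronRoot (hW : W.IsTrulySubstochastic)
    (hD : D.IsStrong) {T : Set V} (hT : T.Finite) :
    ∃ k : ℕ, ∃ p : ℝ, 0 < k ∧ 0 < p ∧ ∀ (F : Finset V) (m : ℕ),
      (∀ l : List {v : V // v ∉ T}, l.IsChain (D.deleteVertices T).Adj → (∀ x ∈ l, (x : V) ∈ F) →
        l.length ≤ m) → p ≤ (k + m) * (1 - W.perronRoot F) := by
  obtain ⟨k, p, hp, hp1, hk⟩ := hW.exists_survival_le_of_finite hD hT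
  -- `k + 1` keeps the exponent nonzero; survival beyond `k + m` steps would already give a path
  -- with `m + 1` vertices.
  refine ⟨k + 1, p, Nat.succ_pos k, hp, fun F m hm => ?_⟩
  have hs : ∀ v ∈ F, W.survival F (k + 1 + m) v ≤ 1 - p := by
    intro v hv
    refine (hW.1.survival_antitone F v (show k + m ≤ k + 1 + m by omega)).trans ?_
    by_contra! hlt
    obtain ⟨hvT, l, hl, hlen, hlF⟩ :=
      hW.1.exists_isChain_of_lt_survival hp1 (fun v hv => hk v hv F) m hv hlt
    have := hm _ hl (by simpa [hv] using hlF)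
    simp [hlen] at this
  have h1 := W.perronRoot_pow_le (by omega) (by linarith) hs
  have h2 := one_add_mul_le_pow (a := W.perronRoot F - 1)
    (by linarith [W.perronRoot_nonneg F]) (k + 1 + m)
  rw [add_sub_cancel] at h2
  push_cast at h2 ⊢
  linarith

theorem IsTrulySubstochastic.exists_lt_mul_one_sub_perronSup (hW : W.IsTrulySubstochastic)
    (hD : D.IsStrong) {T : Set V} (hT : T.Finite) (hcyc : D.IsCycleTransversal T) :
    ∃ c : ℝ, 0 < c ∧ ∀ n : ℕ, 1 ≤ n → c < (n : ℝ) * (1 - W.perronSup n) := by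
  obtain ⟨k, p, hk, hp, h⟩ := hW.exists_le_mul_one_sub_perronRoot hD hT
  have hkR : (0 : ℝ) < k := by exact_mod_cast hk
  -- `n / (k + n) ≥ 1 / (k + 1)` for `n ≥ 1`; `k + 2` makes the inequality strict.
  refine ⟨p / (k + 2), by positivity, fun n hn => ?_⟩
  have hnR : (1 : ℝ) ≤ n := by exact_mod_cast hn
  have h1 : W.perronSup n ≤ 1 - p / (k + n) := by
    refine perronSup_le fun F hF => ?_
    have := h F n fun l hl hlF => ?_
    · rw [le_sub_comm, div_le_iff₀ (by positivity)]
      linarith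
    · classical
      have hnd := (nodup_of_isChain hcyc hl).map Subtype.val_injective
      rw [← List.length_map (f := Subtype.val), ← List.toFinset_card_of_nodup hnd]
      refine (Finset.card_le_card fun x hx => ?_).trans hF
      rw [List.mem_toFinset, List.mem_map] at hx
      obtain ⟨y, hy, rfl⟩ := hx
      exact hlF y hy
  calc p / (k + 2) < p / (k + 1) := by gcongr; norm_num
    _ ≤ n * (p / (k + n)) := by
      rw [← mul_div_assoc, div_le_div_iff₀ (by positivity) (by positivity)]
      nlinarith [mul_nonneg (mul_nonneg hp.le hkR.le) (sub_nonneg.2 hnR)]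
    _ ≤ n * (1 - W.perronSup n) := by gcongr; linarith

theorem IsTrulySubstochastic.exists_lt_one_sub_perronSup (hW : W.IsTrulySubstochastic)
    (hD : D.IsStrong) {T : Set V} (hT : T.Finite) {m : ℕ}
    (hm : ∀ l : List {v : V // v ∉ T}, l.IsChain (D.deleteVertices T).Adj → l.length ≤ m) :
    ∃ δ : ℝ, 0 < δ ∧ ∀ n : ℕ, 1 ≤ n → δ < 1 - W.perronSup n := by
  obtain ⟨k, p, hk, hp, h⟩ := hW.exists_le_mul_one_sub_perronRoot hD hT
  have hkR : (0 : ℝ) < k := by exact_mod_cast hk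
  refine ⟨p / (k + m + 1), by positivity, fun n _ => ?_⟩
  have h1 : W.perronSup n ≤ 1 - p / (k + m) := by
    refine perronSup_le fun F _ => ?_
    rw [le_sub_comm, div_le_iff₀ (by positivity)]
    linarith [h F m fun l hl _ => hm l hl]
  have h2 : p / (k + m + 1) < p / (k + m) :=
    div_lt_div_of_pos_left hp (by positivity) (by linarith)
  linarith

end Weighting

/-! ### Finite sets meeting all long paths. -/

/-- Repetitions need no control: the lemma is applied in an acyclic digraph, where every chain is
free of them. -/
theorem exists_isChain_prepend {α : Type*} {r : α → α → Prop} {x y : α} {l : List α}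
    (h : Relation.ReflTransGen r y x) (hl : (x :: l).IsChain r) :
    ∃ l' : List α, (y :: l').IsChain r ∧
      (y :: l').getLast (List.cons_ne_nil _ _) = (x :: l).getLast (List.cons_ne_nil _ _) ∧
      l.length ≤ l'.length := by
  induction h using Relation.ReflTransGen.head_induction_on with
  | refl => exact ⟨l, hl, rfl, le_rfl⟩
  | @head a c hac _ ih =>
    obtain ⟨l', h1, h2, h3⟩ := ih
    exact ⟨c :: l', List.isChain_cons_cons.2 ⟨hac, h1⟩, by simpa using h2, by simp; omega⟩

theorem exists_isChain_append {α : Type*} {r : α → α → Prop} {x z : α} {l : List α}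
    (hl : (x :: l).IsChain r)
    (h : Relation.ReflTransGen r ((x :: l).getLast (List.cons_ne_nil _ _)) z) :
    ∃ l' : List α, (x :: l').IsChain r ∧ (x :: l').getLast (List.cons_ne_nil _ _) = z ∧
      l.length ≤ l'.length := by
  induction h with
  | refl => exact ⟨l, hl, rfl, le_rfl⟩
  | @tail b c _ hbc ih =>
    obtain ⟨l', h1, h2, h3⟩ := ih
    refine ⟨l' ++ [c], ?_, by simp, by simp; omega⟩
    rw [← List.cons_append, List.isChain_append]
    refine ⟨h1, by simp, fun u hu w hw => ?_⟩
    rw [List.getLast?_eq_some_getLast (List.cons_ne_nil _ _), h2] at hu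
    simp only [Option.mem_def, Option.some.injEq, List.head?_cons] at hu hw
    exact hu ▸ hw ▸ hbc

/-- The arcs of `D` inside the set `U`. -/
def AdjIn (D : Digraph V) (U : Set V) (x y : V) : Prop := D.Adj x y ∧ x ∈ U ∧ y ∈ U

theorem reflTransGen_adjIn_mono {U U' : Set V} (h : U ⊆ U') {x y : V}
    (hxy : Relation.ReflTransGen (D.AdjIn U) x y) : Relation.ReflTransGen (D.AdjIn U') x y :=
  hxy.lift id fun _ _ h' => ⟨h'.1, h h'.2.1, h h'.2.2⟩

theorem exists_finite_path {a b : V} (h : Relation.ReflTransGen D.Adj a b) :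
    ∃ U : Set V, U.Finite ∧ a ∈ U ∧ b ∈ U ∧ ∀ x ∈ U,
      Relation.ReflTransGen (D.AdjIn U) a x ∧ Relation.ReflTransGen (D.AdjIn U) x b := by
  induction h using Relation.ReflTransGen.head_induction_on with
  | refl => exact ⟨{b}, Set.finite_singleton b, rfl, rfl, by
      rintro x rfl; exact ⟨Relation.ReflTransGen.refl, Relation.ReflTransGen.refl⟩⟩
  | @head a c hac _ ih =>
    obtain ⟨U, hU, hc, hb, h⟩ := ih
    have hsub : U ⊆ insert a U := Set.subset_insert a U
    have hstep : D.AdjIn (insert a U) a c := ⟨hac, Set.mem_insert a U, hsub hc⟩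
    refine ⟨insert a U, hU.insert a, Set.mem_insert a U, hsub hb, ?_⟩
    rintro x (rfl | hx)
    · exact ⟨.refl, .head hstep (reflTransGen_adjIn_mono hsub (h c hc).2)⟩
    · exact ⟨.head hstep (reflTransGen_adjIn_mono hsub (h x hx).1),
        reflTransGen_adjIn_mono hsub (h x hx).2⟩

/-- In a strong digraph every finite set of vertices lies in a finite set inducing a strong
digraph. -/
theorem IsStrong.exists_finite_superset (hD : D.IsStrong) (o : V) {T : Set V} (hT : T.Finite) :
    ∃ U : Set V, U.Finite ∧ T ⊆ U ∧ o ∈ U ∧ ∀ x ∈ U,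
      Relation.ReflTransGen (D.AdjIn U) o x ∧ Relation.ReflTransGen (D.AdjIn U) x o := by
  induction T, hT using Set.Finite.induction_on with
  | empty => exact ⟨{o}, Set.finite_singleton o, Set.empty_subset _, rfl, by
      rintro x rfl; exact ⟨.refl, .refl⟩⟩
  | @insert a s _ _ ih =>
    obtain ⟨U, hU, hs, ho, h⟩ := ih
    obtain ⟨P, hP, hPo, hPa, hPx⟩ := exists_finite_path (hD.reflTransGen o a)
    obtain ⟨Q, hQ, hQa, hQo, hQx⟩ := exists_finite_path (hD.reflTransGen a o)
    have hsU : U ⊆ U ∪ (P ∪ Q) := Set.subset_union_left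
    have hsP : P ⊆ U ∪ (P ∪ Q) := Set.subset_union_left.trans Set.subset_union_right
    have hsQ : Q ⊆ U ∪ (P ∪ Q) := Set.subset_union_right.trans Set.subset_union_right
    refine ⟨U ∪ (P ∪ Q), hU.union (hP.union hQ), Set.insert_subset (hsP hPa) (hs.trans hsU),
      hsU ho, ?_⟩
    have hoa := reflTransGen_adjIn_mono hsP (hPx a hPa).1
    have hao := reflTransGen_adjIn_mono hsQ (hQx a hQa).2
    rintro x (hx | hx | hx)
    · exact ⟨reflTransGen_adjIn_mono hsU (h x hx).1, reflTransGen_adjIn_mono hsU (h x hx).2⟩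
    · exact ⟨reflTransGen_adjIn_mono hsP (hPx x hx).1,
        (reflTransGen_adjIn_mono hsP (hPx x hx).2).trans hao⟩
    · exact ⟨hoa.trans (reflTransGen_adjIn_mono hsQ (hQx x hx).1),
        reflTransGen_adjIn_mono hsQ (hQx x hx).2⟩

/-- After its last visit to `U`, a walk ending outside `U` stays outside. -/
theorem exists_last_exit {U : Set V} {o : V} (ho : o ∈ U) {x : V}
    (h : Relation.ReflTransGen D.Adj o x) (hx : x ∉ U) :
    ∃ a ∈ U, ∃ y : {v : V // v ∉ U}, D.Adj a y ∧
      Relation.ReflTransGen (D.deleteVertices U).Adj y ⟨x, hx⟩ := by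
  induction h with
  | refl => exact absurd ho hx
  | @tail b c _ hbc ih =>
    by_cases hb : b ∈ U
    · exact ⟨b, hb, ⟨c, hx⟩, hbc, .refl⟩
    · obtain ⟨a, ha, y, hay, hy⟩ := ih hb
      exact ⟨a, ha, y, hay, hy.tail hbc⟩

theorem exists_first_entry {U : Set V} {o : V} (ho : o ∈ U) {x : V}
    (h : Relation.ReflTransGen D.Adj x o) (hx : x ∉ U) :
    ∃ b ∈ U, ∃ z : {v : V // v ∉ U}, D.Adj z b ∧
      Relation.ReflTransGen (D.deleteVertices U).Adj ⟨x, hx⟩ z := by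
  induction h using Relation.ReflTransGen.head_induction_on with
  | refl => exact absurd ho hx
  | @head a c hac _ ih =>
    by_cases hc : c ∈ U
    · exact ⟨c, hc, ⟨a, hx⟩, hac, .refl⟩
    · obtain ⟨b, hb, z, hzb, hz⟩ := ih hc
      exact ⟨b, hb, z, hzb, .head (show (D.deleteVertices U).Adj ⟨a, hx⟩ ⟨c, hc⟩ from hac) hz⟩

/-- In a strong digraph with a finite cycle transversal and bounded cycle lengths, some finite set
of vertices meets all long paths. -/
theorem IsStrong.exists_finite_forall_length_le (hD : D.IsStrong) (o : V) {T : Set V}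
    (hT : T.Finite) (hcyc : D.IsCycleTransversal T) {L : ℕ} (hL : ∀ l ∈ D.cycleLengths, l ≤ L) :
    ∃ U : Set V, U.Finite ∧ ∀ l : List {v : V // v ∉ U},
      l.IsChain (D.deleteVertices U).Adj → l.length ≤ L := by
  obtain ⟨U, hU, hTU, ho, hcon⟩ := hD.exists_finite_superset o hT
  refine ⟨U, hU, fun l hl => ?_⟩
  have hacyc : D.IsCycleTransversal U := hcyc.mono hTU
  rcases l with _ | ⟨x, l⟩
  · simp
  -- Extend the path backwards and forwards outside `U` until it is adjacent to `U` at both ends,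
  -- then join `b` to `a` by a simple path inside `U`. The result is a cycle at least as long as the
  -- path.
  obtain ⟨a, ha, y, hay, hy⟩ := exists_last_exit ho (hD.reflTransGen o x) x.2
  set e := (x :: l).getLast (List.cons_ne_nil _ _) with he
  obtain ⟨b, hb, z, hzb, hz⟩ := exists_first_entry ho (hD.reflTransGen e o) e.2
  obtain ⟨l₁, hl₁, hlast₁, hlen₁⟩ := exists_isChain_append hl hz
  obtain ⟨l₂, hl₂, hlast₂, hlen₂⟩ := exists_isChain_prepend hy hl₁
  rw [hlast₁] at hlast₂
  obtain ⟨q, hqn, hqc, hqlast⟩ :=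
    exists_nodup_isChain_of_reflTransGen ((hcon b hb).2.trans (hcon a ha).1)
  have hqU : ∀ v ∈ b :: q, v ∈ U := by
    intro v hv
    rcases List.mem_cons.1 hv with rfl | hv
    · exact hb
    · obtain ⟨s, t, rfl⟩ := List.append_of_mem hv
      have h1 : ((b :: s) ++ v :: t).IsChain (D.AdjIn U) := hqc
      rw [List.isChain_append] at h1
      exact (h1.2.2 _ (List.getLast?_eq_some_getLast (List.cons_ne_nil b s)) v (by simp)).2.2
  set P := (y :: l₂).map Subtype.val with hP
  have hPn : P.Nodup := (nodup_of_isChain hacyc hl₂).map Subtype.val_injective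
  have hPc : P.IsChain D.Adj := List.isChain_map_of_isChain Subtype.val (fun _ _ h => h) hl₂
  have hne : P ++ b :: q ≠ [] := by simp
  have hmem : (P ++ b :: q).length ∈ D.cycleLengths := by
    refine length_mem_cycleLengths hne ?_ ?_ ?_
    · refine hPn.append hqn fun v hv hv' => ?_
      obtain ⟨w, -, rfl⟩ := List.mem_map.1 hv
      exact w.2 (hqU _ hv')
    · rw [List.isChain_append]
      refine ⟨hPc, hqc.imp fun _ _ h => h.1, fun u hu w hw => ?_⟩
      have hu' : (z : V) = u := by
        rw [hP, List.getLast?_map, List.getLast?_eq_some_getLast (List.cons_ne_nil _ _),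
          hlast₂] at hu
        simpa using hu
      have hw' : b = w := by simpa using hw
      exact hu' ▸ hw' ▸ hzb
    · rw [List.getLast_append_of_ne_nil hne (List.cons_ne_nil b q), hqlast]
      simpa [hP] using hay
  have := hL _ hmem
  simp [hP] at this ⊢
  omega

end Digraph

/-! ### Weightings that are large along chosen cycles. -/

namespace Digraph

open Classical in
/-- Probability weights on a countable set with prescribed lower bounds at the points `nxt k`,
`k ∈ K`. -/
theorem exists_weights {O : Type*} [Countable O] (K : Set ℕ) (nxt : ℕ → O) {ε η : ℕ → NNReal}
    (hε0 : ∀ k, 0 < ε k) (hε1 : ∀ k, ε k < 1) (hε : Antitone ε)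
    (hη : ∑' k, (η k : ENNReal) < 1 / 2) :
    ∃ f : O → ℝ, (∀ w, 0 < f w) ∧ ∑' w, ENNReal.ofReal (f w) < 1 ∧
      (∀ k ∈ K, (ε k * η k : ℝ) ≤ f (nxt k)) ∧
      ∀ k ∈ K, (∀ j < k, j ∉ K) → (1 - ε k : ℝ) ≤ f (nxt k) := by
  -- `κ` is the first element of `K`, if there is one
  set κ := sInf K with hκ
  have hκle : ∀ k ∈ K, κ ≤ k := fun k hk => Nat.sInf_le hk
  have hhalf : ((ε κ / 2 : NNReal) : ENNReal) ≠ 0 := by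
    simpa using (hε0 κ).ne'
  obtain ⟨θ, hθ0, hθ⟩ := ENNReal.exists_pos_sum_of_countable hhalf O
  -- The three parts have totals below `ε κ / 2`, at most `ε κ / 2`, and equal to `1 - ε κ`:
  -- positivity everywhere, a share for every `k ∈ K`, and the bulk for the first cycle. For empty
  -- `K` the default `κ = 0` is harmless.
  set G : O → ENNReal := fun w => θ w + (∑' k, if k ∈ K ∧ nxt k = w then (ε κ * η k : ENNReal) else 0)
    + if nxt κ = w then ((1 - ε κ : NNReal) : ENNReal) else 0 with hG
  have hsum : ∑' w, G w < 1 := by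
    have h1 : ∑' w, ∑' k, (if k ∈ K ∧ nxt k = w then (ε κ * η k : ENNReal) else 0) ≤
        (ε κ / 2 : NNReal) := by
      rw [ENNReal.tsum_comm]
      calc ∑' k, ∑' w, (if k ∈ K ∧ nxt k = w then (ε κ * η k : ENNReal) else 0)
          ≤ ∑' k, (ε κ * η k : ENNReal) := by
            refine ENNReal.tsum_le_tsum fun k => ?_
            rw [tsum_eq_single (nxt k)]
            · split_ifs <;> simp
            · intro w hw
              rw [if_neg fun h => hw h.2.symm]
        _ = ε κ * ∑' k, (η k : ENNReal) := ENNReal.tsum_mul_left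
        _ ≤ ε κ * (1 / 2) := by gcongr
        _ = (ε κ / 2 : NNReal) := by
          rw [ENNReal.coe_div two_ne_zero, mul_one_div]
          rfl
    have h2 : ∑' w, (if nxt κ = w then ((1 - ε κ : NNReal) : ENNReal) else 0) =
        ((1 - ε κ : NNReal) : ENNReal) := by
      rw [tsum_eq_single (nxt κ)]
      · simp
      · intro w hw
        rw [if_neg hw.symm]
    simp only [hG]
    rw [ENNReal.tsum_add, ENNReal.tsum_add, h2]
    calc _ < ((ε κ / 2 : NNReal) : ENNReal) + (ε κ / 2 : NNReal) + (1 - ε κ : NNReal) := by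
          refine ENNReal.add_lt_add_right ENNReal.coe_ne_top ?_
          refine ENNReal.add_lt_add_of_lt_of_le ?_ hθ h1
          exact ne_top_of_le_ne_top ENNReal.coe_ne_top h1
      _ = 1 := by
        rw [← ENNReal.coe_add, ← ENNReal.coe_add, add_halves, add_tsub_cancel_of_le (hε1 κ).le,
          ENNReal.coe_one]
  have hfin : ∀ w, G w ≠ ⊤ := fun w =>
    ((ENNReal.le_tsum w).trans_lt (hsum.trans ENNReal.one_lt_top)).ne
  have hle : ∀ (w : O) (x : NNReal), (x : ENNReal) ≤ G w → (x : ℝ) ≤ (G w).toReal := fun w x h => by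
    simpa using ENNReal.toReal_mono (hfin w) h
  refine ⟨fun w => (G w).toReal, fun w => ?_, ?_, fun k hk => ?_, fun k hk hfirst => ?_⟩
  · refine lt_of_lt_of_le (NNReal.coe_pos.2 (hθ0 w)) (hle w (θ w) ?_)
    simp only [hG, add_assoc]
    exact le_self_add
  · simpa only [ENNReal.ofReal_toReal (hfin _)] using hsum
  · have h1 : ((ε κ * η k : NNReal) : ENNReal) ≤ G (nxt k) := by
      simp only [hG]
      refine le_trans (le_trans ?_ le_add_self) le_self_add
      refine le_trans ?_ (ENNReal.le_tsum k)
      rw [if_pos ⟨hk, rfl⟩, ENNReal.coe_mul]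
    have h2 := hle _ _ h1
    push_cast at h2
    refine le_trans ?_ h2
    gcongr
    exact hε (hκle k hk)
  · have hkκ : κ = k := by
      refine (hκle k hk).antisymm (not_lt.1 fun h => hfirst κ h (Nat.sInf_mem ⟨k, hk⟩))
    have h1 : ((1 - ε κ : NNReal) : ENNReal) ≤ G (nxt k) := by
      simp only [hG]
      rw [if_pos (by rw [hkκ])]
      exact le_add_self
    have h2 := hle _ _ h1
    rwa [NNReal.coe_sub (hε1 κ).le, hkκ] at h2

variable {V : Type*} {D : Digraph V}

/-- A truly substochastic weighting that is large along the arcs of given cycles. -/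
theorem exists_weighting [Countable V] [Nonempty V] (C : ℕ → D.CycleSeq) {ε η : ℕ → NNReal}
    (hε0 : ∀ k, 0 < ε k) (hε1 : ∀ k, ε k < 1) (hε : Antitone ε)
    (hη : ∑' k, (η k : ENNReal) < 1 / 2) :
    ∃ S : D.Weighting, S.IsTrulySubstochastic ∧
      (∀ k i, (ε k * η k : ℝ) ≤ S.adjMatrix ((C k).seq i) ((C k).seq (i + 1))) ∧
      ∀ k i, (∀ j < k, (C k).seq i ∉ (C j).support) →
        (1 - ε k : ℝ) ≤ S.adjMatrix ((C k).seq i) ((C k).seq (i + 1)) := by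
  have key : ∀ v : V, ∃ f : {w : V // D.Adj v w} → ℝ, (∀ w, 0 < f w) ∧
      ∑' w, ENNReal.ofReal (f w) < 1 ∧
      ∀ k i (h : (C k).seq i = v),
        (ε k * η k : ℝ) ≤ f ⟨(C k).seq (i + 1), h ▸ (C k).adj i⟩ ∧
        ((∀ j < k, v ∉ (C j).support) →
          (1 - ε k : ℝ) ≤ f ⟨(C k).seq (i + 1), h ▸ (C k).adj i⟩) := by
    intro v
    by_cases hO : IsEmpty {w : V // D.Adj v w}
    · refine ⟨isEmptyElim, isEmptyElim, by simp, fun k i h => ?_⟩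
      exact isEmptyElim (⟨(C k).seq (i + 1), h ▸ (C k).adj i⟩ : {w : V // D.Adj v w})
    rw [not_isEmpty_iff] at hO
    have hnxt : ∀ k, ∃ w : {w : V // D.Adj v w}, ∀ i (h : (C k).seq i = v),
        w = ⟨(C k).seq (i + 1), h ▸ (C k).adj i⟩ := by
      intro k
      by_cases hk : ∃ i, (C k).seq i = v
      · obtain ⟨i, hi⟩ := hk
        exact ⟨⟨(C k).seq (i + 1), hi ▸ (C k).adj i⟩, fun j hj =>
          Subtype.ext ((C k).seq_succ_eq (hi.trans hj.symm))⟩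
      · exact ⟨Classical.arbitrary _, fun i hi => (hk ⟨i, hi⟩).elim⟩
    choose nxt hnxt using hnxt
    obtain ⟨f, h0, h1, h2, h3⟩ :=
      exists_weights {k | v ∈ (C k).support} nxt hε0 hε1 hε hη
    refine ⟨f, h0, h1, fun k i h => ?_⟩
    rw [← hnxt k i h]
    have hk : v ∈ (C k).support := h ▸ (C k).seq_mem_support i
    exact ⟨h2 k hk, h3 k hk⟩
  choose f hf0 hf1 hf using key
  set S : D.Weighting := ⟨fun a => f a.1.1 ⟨a.1.2, a.2⟩, fun a => hf0 _ _⟩ with hS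
  refine ⟨S, ⟨fun v => (hf1 v).le, ⟨Classical.arbitrary V, hf1 _⟩⟩, fun k i => ?_, fun k i h => ?_⟩
  · rw [S.adjMatrix_of_adj ((C k).adj i)]
    exact (hf _ k i rfl).1
  · rw [S.adjMatrix_of_adj ((C k).adj i)]
    exact (hf _ k i rfl).2 h

open Classical in
/-- Choose cycles one after the other, each depending on the union of the previous ones. -/
theorem exists_seq_cycleSeq {P : ℕ → Finset V → D.CycleSeq → Prop} (h : ∀ k U, ∃ C, P k U C) :
    ∃ (C : ℕ → D.CycleSeq) (U : ℕ → Finset V), U 0 = ∅ ∧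
      (∀ k, U (k + 1) = U k ∪ (C k).support) ∧ ∀ k, P k (U k) (C k) := by
  choose nxt hnxt using h
  set U : ℕ → Finset V := fun k => Nat.rec ∅ (fun k U => U ∪ (nxt k U).support) k with hU
  exact ⟨fun k => nxt k (U k), U, rfl, fun k => rfl, fun k => hnxt k (U k)⟩

/-- Take `h n = (2 + ∑ i ≤ n, 1 / g i)⁻¹`. -/
theorem exists_antitone_lt {g : ℕ → ℝ} (hg : ∀ n, 0 < g n) :
    ∃ h : ℕ → NNReal, Antitone h ∧ ∀ n, 0 < h n ∧ h n < 1 ∧ (h n : ℝ) < g n := by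
  have hs : ∀ n, 0 ≤ ∑ i ∈ Finset.range (n + 1), (g i)⁻¹ := fun n =>
    Finset.sum_nonneg fun i _ => (inv_pos.2 (hg i)).le
  have hpos : ∀ n, 0 < 2 + ∑ i ∈ Finset.range (n + 1), (g i)⁻¹ := fun n => by linarith [hs n]
  have hex : ∀ n, ∃ x : NNReal, (x : ℝ) = (2 + ∑ i ∈ Finset.range (n + 1), (g i)⁻¹)⁻¹ := fun n =>
    ⟨⟨_, (inv_pos.2 (hpos n)).le⟩, rfl⟩
  choose h hh using hex
  refine ⟨h, fun m n hmn => ?_, fun n => ⟨?_, ?_, ?_⟩⟩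
  · rw [← NNReal.coe_le_coe, hh, hh]
    refine inv_anti₀ (hpos m) (add_le_add_right ?_ 2)
    exact Finset.sum_le_sum_of_subset_of_nonneg (by simpa using hmn)
      fun i _ _ => (inv_pos.2 (hg i)).le
  · rw [← NNReal.coe_pos, hh]
    exact inv_pos.2 (hpos n)
  · rw [← NNReal.coe_lt_coe, hh]
    exact inv_lt_one_of_one_lt₀ (by linarith [hs n])
  · rw [hh]
    refine inv_lt_of_inv_lt₀ (hg n) ?_
    have := Finset.single_le_sum (f := fun i => (g i)⁻¹) (fun i _ => (inv_pos.2 (hg i)).le)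
      (Finset.self_mem_range_succ n)
    linarith

/-- If no finite set is a cycle transversal, the Perron roots can approach one arbitrarily fast. -/
theorem exists_one_sub_perronSup_lt [Countable V] (hne : D.cycleLengths.Nonempty)
    (hT : ∀ T : Set V, T.Finite → ¬ D.IsCycleTransversal T) {g : ℕ → ℝ} (hg : ∀ n, 0 < g n) :
    ∃ S : D.Weighting, S.IsTrulySubstochastic ∧
      ∀ n : ℕ, D.minCycleLength ≤ (n : ℕ∞) → 1 - S.perronSup n < g n := by
  classical
  obtain ⟨h, hanti, hh⟩ := exists_antitone_lt hg
  obtain ⟨l, hl, hmin⟩ := exists_shortest_cycle hne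
  obtain ⟨C₀, hC₀⟩ := exists_cycleSeq hl
  -- The first cycle is a shortest one, so that every `n ≥ minCycleLength` is served; its
  -- disjointness from `U 0 = ∅` is automatic.
  obtain ⟨C, U, hU0, hU, hC⟩ := exists_seq_cycleSeq
    (P := fun k U C => if k = 0 then C.length = l else Disjoint C.support U) (D := D) fun k U => by
      by_cases hk : k = 0
      · exact ⟨C₀, by simpa [hk] using hC₀⟩
      · simpa [hk] using exists_cycleSeq_disjoint (hT U U.finite_toSet)
  have hdisj : ∀ k, Disjoint (C k).support (U k) := by
    intro k
    rcases k with _ | k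
    · simp [hU0]
    · simpa using hC (k + 1)
  have hlen0 : (C 0).length = l := by simpa using hC 0
  have hUmono : Monotone U := monotone_nat_of_le_succ fun k => by
    rw [hU]; exact Finset.subset_union_left
  have hcard : ∀ k, (U (k + 1)).card = (U k).card + (C k).length := fun k => by
    rw [hU, Finset.card_union_of_disjoint (hdisj k).symm, CycleSeq.card_support]
  have hgrow : ∀ k, k ≤ (U k).card := by
    intro k
    induction k with
    | zero => simp
    | succ k ih => have := (C k).length_pos; have := hcard k; omega
  obtain ⟨η, hη0, hη⟩ := ENNReal.exists_pos_sum_of_countable (ε := 1 / 2) (by simp) ℕ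
  have : Nonempty V := ⟨C₀.seq 0⟩
  -- `C k` must serve every `n` below the size of `U (k + 2)`, from which on `C (k + 1)` takes over;
  -- since `h` is antitone, its value there is small enough for all these `n`.
  obtain ⟨S, hS, -, hS1⟩ := exists_weighting C (ε := fun k => h (U (k + 2)).card) (η := η)
    (fun k => (hh _).1) (fun k => (hh _).2.1)
    (fun j k hjk => hanti (Finset.card_le_card (hUmono (by omega)))) hη
  refine ⟨S, hS, fun n hn => ?_⟩
  have hln := hmin n hn
  obtain ⟨k, hk1, hk2⟩ : ∃ k, (U (k + 1)).card ≤ n ∧ n < (U (k + 2)).card := by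
    have hex : ∃ k, n < (U (k + 1)).card := ⟨n, hgrow (n + 1)⟩
    have hspec := Nat.find_spec hex
    obtain ⟨k, hk⟩ := Nat.exists_eq_succ_of_ne_zero (n := Nat.find hex) fun h0 => by
      rw [h0, hcard, hU0, hlen0] at hspec
      simp at hspec
      omega
    refine ⟨k, not_lt.1 (Nat.find_min hex (by omega)), ?_⟩
    rwa [hk] at hspec
  have hnew : ∀ i, ∀ j < k, (C k).seq i ∉ (C j).support := fun i j hj hmem => by
    refine Finset.disjoint_left.1 (hdisj k) ((C k).seq_mem_support i) ?_
    refine hUmono (show j + 1 ≤ k from hj) ?_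
    rw [hU]
    exact Finset.mem_union_right _ hmem
  have hε1 : (h (U (k + 2)).card : ℝ) < 1 := by exact_mod_cast (hh _).2.1
  have h1 : 1 - (h (U (k + 2)).card : ℝ) ≤ S.perronRoot (C k).support := by
    refine S.le_perronRoot_of_closed_walk (C k).seq_mem_support (C k).length_pos
      (by simpa using (C k).periodic 0) (by linarith) ?_
    calc _ = ∏ i ∈ Finset.range (C k).length, (1 - (h (U (k + 2)).card : ℝ)) := by simp
      _ ≤ _ := Finset.prod_le_prod (fun i _ => by linarith) fun i _ => hS1 k i (hnew i)
  have h2 : S.perronRoot (C k).support ≤ S.perronSup n :=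
    hS.1.perronRoot_le_perronSup (by rw [CycleSeq.card_support]; have := hcard k; omega)
  have h3 : (h (U (k + 2)).card : ℝ) ≤ h n := by exact_mod_cast hanti hk2.le
  linarith [(hh n).2.2]

/-- If the cycles are arbitrarily long, the Perron roots can approach one. -/
theorem exists_forall_exists_one_sub_perronSup_lt [Countable V]
    (hlong : ∀ L : ℕ, ∃ l ∈ D.cycleLengths, L < l) :
    ∃ S : D.Weighting, S.IsTrulySubstochastic ∧
      ∀ δ : ℝ, 0 < δ → ∃ n : ℕ, 1 ≤ n ∧ 1 - S.perronSup n < δ := by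
  classical
  obtain ⟨η, hη0, hη⟩ := ENNReal.exists_pos_sum_of_countable (ε := 1 / 2) (by simp) ℕ
  set ε : ℕ → NNReal := fun k => 1 / (k + 2) with hε
  have hεR : ∀ k, (ε k : ℝ) = 1 / (k + 2) := fun k => by simp [hε]
  have hε0 : ∀ k, 0 < ε k := fun k => by simp only [hε]; positivity
  have hε1 : ∀ k, ε k < 1 := fun k => by
    rw [← NNReal.coe_lt_coe, hεR, NNReal.coe_one, div_lt_one (by positivity)]
    linarith [(Nat.cast_nonneg k : (0 : ℝ) ≤ k)]
  have hεanti : Antitone ε := fun j k hjk => by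
    rw [← NNReal.coe_le_coe, hεR, hεR]
    gcongr
  have hη1 : ∀ k, (η k : ℝ) < 1 := fun k => by
    have h1 : (η k : ENNReal) < 1 := (ENNReal.le_tsum k).trans_lt (hη.trans (by simp))
    exact_mod_cast h1
  have hε0R : ∀ k, (0 : ℝ) < ε k := fun k => NNReal.coe_pos.2 (hε0 k)
  have hη0R : ∀ k, (0 : ℝ) < η k := fun k => NNReal.coe_pos.2 (hη0 k)
  have hε1R : ∀ k, (ε k : ℝ) < 1 := fun k => by exact_mod_cast hε1 k
  have hpos : ∀ k, 0 < (ε k * η k : ℝ) := fun k => mul_pos (hε0R k) (hη0R k)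
  have hle1 : ∀ k, (ε k * η k : ℝ) ≤ 1 := fun k =>
    mul_le_one₀ (hε1R k).le (hη0R k).le (hη1 k).le
  -- At most `U.card` arcs of the new cycle start in `U`, where only the weight `ε k * η k` is
  -- guaranteed. The length is chosen so that this costs at most one further factor `(1 - ε k) ^
  -- C.length`, whence the geometric mean is at least `(1 - ε k) ^ 2`.
  obtain ⟨C, U, hU0, hU, hC⟩ := exists_seq_cycleSeq (D := D)
    (P := fun k U C => (1 - ε k : ℝ) ^ C.length ≤ (ε k * η k : ℝ) ^ U.card) fun k U => by
      obtain ⟨L, hL⟩ := exists_pow_lt_of_lt_one (pow_pos (hpos k) U.card)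
        (show (1 - ε k : ℝ) < 1 by linarith [hε0R k])
      obtain ⟨l, hl, hLl⟩ := hlong L
      obtain ⟨c, rfl⟩ := exists_cycleSeq hl
      exact ⟨c, (pow_le_pow_of_le_one (by linarith [hε1R k]) (by linarith [hε0R k])
        hLl.le).trans hL.le⟩
  have : Nonempty V := ⟨(C 0).seq 0⟩
  obtain ⟨S, hS, hS1, hS2⟩ := exists_weighting C hε0 hε1 hεanti hη
  refine ⟨S, hS, fun δ hδ => ?_⟩
  obtain ⟨k, hk⟩ := exists_nat_one_div_lt (half_pos hδ)
  refine ⟨(C k).length, (C k).length_pos, ?_⟩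
  have hUsub : ∀ j k, j < k → (C j).support ⊆ U k := fun j k hjk => by
    have hUmono : Monotone U := monotone_nat_of_le_succ fun k => by
      rw [hU]; exact Finset.subset_union_left
    refine Finset.Subset.trans ?_ (hUmono (show j + 1 ≤ k from hjk))
    rw [hU]
    exact Finset.subset_union_right
  have h1 : (1 - ε k : ℝ) ^ 2 ≤ S.perronRoot (C k).support := by
    refine S.le_perronRoot_of_closed_walk (C k).seq_mem_support (C k).length_pos
      (by simpa using (C k).periodic 0) (by positivity) ?_
    calc ((1 - ε k : ℝ) ^ 2) ^ (C k).length
        = (1 - ε k : ℝ) ^ (C k).length * (1 - ε k : ℝ) ^ (C k).length := by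
          rw [← pow_mul, two_mul, pow_add]
      _ ≤ (1 - ε k : ℝ) ^ (C k).length * (ε k * η k : ℝ) ^ (U k).card := by
        gcongr
        · exact pow_nonneg (by linarith [hε1R k]) _
        · exact hC k
      _ ≤ (1 - ε k : ℝ) ^ (C k).length *
          (ε k * η k : ℝ) ^ ((Finset.range (C k).length).filter fun i => (C k).seq i ∈ U k).card := by
        refine mul_le_mul_of_nonneg_left ?_ (pow_nonneg (by linarith [hε1R k]) _)
        refine pow_le_pow_of_le_one (hpos k).le (hle1 k) ?_
        refine Finset.card_le_card_of_injOn (C k).seq (fun i hi => (Finset.mem_filter.1 hi).2) ?_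
        exact (C k).injOn.mono (Finset.coe_subset.2 (Finset.filter_subset _ _))
      _ = ∏ i ∈ Finset.range (C k).length,
          ((1 - ε k : ℝ) * if (C k).seq i ∈ U k then (ε k * η k : ℝ) else 1) := by
        rw [Finset.prod_mul_distrib, Finset.prod_const, Finset.card_range, Finset.prod_ite]
        simp
      _ ≤ _ := by
        refine Finset.prod_le_prod (fun i _ => ?_) fun i _ => ?_
        · refine mul_nonneg (by linarith [hε1R k]) ?_
          split_ifs
          exacts [(hpos k).le, zero_le_one]
        · split_ifs with hi
          · refine le_trans ?_ (hS1 k i)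
            exact mul_le_of_le_one_left (hpos k).le (by linarith [hε0R k])
          · rw [mul_one]
            exact hS2 k i fun j hj hmem => hi (hUsub j k hj hmem)
  have h2 : S.perronRoot (C k).support ≤ S.perronSup (C k).length :=
    hS.1.perronRoot_le_perronSup (C k).card_support.le
  have h3 : (ε k : ℝ) ≤ 1 / (k + 1) := by
    rw [hεR]
    gcongr
    norm_num
  nlinarith [sq_nonneg (ε k : ℝ)]

end Digraph

/-! ### The dichotomy and the two characterizations. -/

theorem corollary2 {V : Type*} [Countable V] (D : Digraph V) (hD : D.IsStrong)
    (harc : ∃ v w : V, D.Adj v w) :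
    Xor
      (∀ g : ℕ → ℝ, (∀ n, 0 < g n) →
        ∃ S : D.Weighting, S.IsTrulySubstochastic ∧
          ∀ n : ℕ, D.minCycleLength ≤ (n : ℕ∞) → 1 - S.perronSup n < g n)
      (∀ S : D.Weighting, S.IsTrulySubstochastic →
        ∃ c : ℝ, 0 < c ∧ ∀ n : ℕ, 1 ≤ n → c < (n : ℝ) * (1 - S.perronSup n)) ∧
    ((∀ S : D.Weighting, S.IsTrulySubstochastic →
        ∃ c : ℝ, 0 < c ∧ ∀ n : ℕ, 1 ≤ n → c < (n : ℝ) * (1 - S.perronSup n)) ↔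
      D.sctCard < ⊤) ∧
    ((∀ S : D.Weighting, S.IsTrulySubstochastic →
        ∃ δ : ℝ, 0 < δ ∧ ∀ n : ℕ, 1 ≤ n → δ < 1 - S.perronSup n) ↔
      D.sctCard < ⊤ ∧ D.maxCycleLength < ⊤) := by
  have hne := hD.cycleLengths_nonempty harc
  set A : Prop := ∀ g : ℕ → ℝ, (∀ n, 0 < g n) → ∃ S : D.Weighting, S.IsTrulySubstochastic ∧
    ∀ n : ℕ, D.minCycleLength ≤ (n : ℕ∞) → 1 - S.perronSup n < g n with hA
  set B : Prop := ∀ S : D.Weighting, S.IsTrulySubstochastic →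
    ∃ c : ℝ, 0 < c ∧ ∀ n : ℕ, 1 ≤ n → c < (n : ℝ) * (1 - S.perronSup n) with hB
  have hfinB : D.sctCard < ⊤ → B := fun h S hS => by
    obtain ⟨T, hT, hcyc⟩ := Digraph.sctCard_lt_top_iff.1 h
    exact hS.exists_lt_mul_one_sub_perronSup hD hT hcyc
  have hinfA : ¬ D.sctCard < ⊤ → A := fun h g hg =>
    Digraph.exists_one_sub_perronSup_lt hne
      (fun T hT hcyc => h (Digraph.sctCard_lt_top_iff.2 ⟨T, hT, hcyc⟩)) hg
  have hAB : A → ¬ B := by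
    intro ha hb
    -- This decay forces `n * (1 - perronSup n) < 1 / (n + 1)`, which contradicts any positive
    -- constant `c` for large `n`.
    obtain ⟨S, hS, h⟩ := ha (fun n => 1 / ((n : ℝ) + 1) ^ 2) fun n => by positivity
    obtain ⟨c, hc, h'⟩ := hb S hS
    obtain ⟨l, -, hl⟩ : ∃ l : ℕ, l ∈ D.cycleLengths ∧ D.minCycleLength ≤ l := by
      obtain ⟨l, hl⟩ := hne
      exact ⟨l, hl, iInf₂_le l hl⟩
    obtain ⟨m, hm⟩ := exists_nat_one_div_lt hc
    have hn1 : 1 ≤ l + m + 1 := by omega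
    have h1 := h (l + m + 1) (hl.trans (by exact_mod_cast (by omega : l ≤ l + m + 1)))
    have h2 := h' (l + m + 1) hn1
    set n := l + m + 1 with hn
    have hnR : (0 : ℝ) < n := by exact_mod_cast hn1
    have h3 : (n : ℝ) * (1 - S.perronSup n) < 1 / (n + 1) :=
      calc (n : ℝ) * (1 - S.perronSup n) < n * (1 / ((n : ℝ) + 1) ^ 2) := by gcongr
        _ ≤ (n + 1) * (1 / ((n : ℝ) + 1) ^ 2) := by gcongr; linarith
        _ = 1 / (n + 1) := by field_simp
    have h4 : 1 / ((n : ℝ) + 1) ≤ 1 / (m + 1) := by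
      gcongr
      omega
    linarith
  have hBfin : B → D.sctCard < ⊤ := fun hb => by
    by_contra h
    exact hAB (hinfA h) hb
  refine ⟨?_, ⟨hBfin, hfinB⟩, fun hδ => ?_, fun ⟨hsct, hmax⟩ S hS => ?_⟩
  · by_cases h : D.sctCard < ⊤
    · exact Or.inr ⟨hfinB h, fun ha => hAB ha (hfinB h)⟩
    · exact Or.inl ⟨hinfA h, hAB (hinfA h)⟩
  · refine ⟨hBfin fun S hS => ?_, ?_⟩
    · obtain ⟨δ, hδ0, h⟩ := hδ S hS
      refine ⟨δ, hδ0, fun n hn => ?_⟩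
      have hnR : (1 : ℝ) ≤ n := by exact_mod_cast hn
      nlinarith [h n hn]
    · by_contra hmax
      obtain ⟨S, hS, h⟩ := Digraph.exists_forall_exists_one_sub_perronSup_lt (D := D) fun L => by
        by_contra! hcon
        exact hmax (Digraph.maxCycleLength_lt_top_iff.2 ⟨L, hcon⟩)
      obtain ⟨δ, hδ0, h'⟩ := hδ S hS
      obtain ⟨n, hn, hlt⟩ := h δ hδ0
      exact lt_asymm hlt (h' n hn)
  · obtain ⟨T, hT, hcyc⟩ := Digraph.sctCard_lt_top_iff.1 hsct
    obtain ⟨L, hL⟩ := Digraph.maxCycleLength_lt_top_iff.1 hmax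
    obtain ⟨o, -⟩ := harc
    obtain ⟨U, hU, hlen⟩ := hD.exists_finite_forall_length_le o hT hcyc hL
    exact hS.exists_lt_one_sub_perronSup hD hU hlen
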